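/- **Setting.** States are in $\mathbb R^{2n}$, inputs in $\mathbb R^p$. The pursuer and the evader satisfy $$\dot z_p=f_p(z_p)+g_p(z_p)(u_p+d),\qquad \dot z_e=f_e(z_e)+g_e(z_e)u_e ,$$ with $f_p,g_p,f_e,g_e$ locally Lipschitz, $f_p(0)=0$, $g_p(z)$ of full column rank. Put $\xi=z_p-z_e$ and $\mathcal F(z_p,z_e)=f_p(z_p)-f_e(z_e)$. The reward is $\ell(\xi,u_n,u_e)=Q(\xi)+u_n^\top Ru_n-\gamma^2u_e^\top Tu_e$ with $Q$ continuous and positive definite, $R,T\succ0$, $\gamma>0$. The position constraint is $b_x(z_p,x_o)\ge0$ ($x_o(t)\in\mathbb R^n$ is the position of an obstacle; $b_x\in C^2$, $L_{f_p}b_x\in C^1$, relative degree two) and the velocity constraint is $b_v(z_p)\ge0$ ($b_v\in C^1$, relative degree one). For constants $k,p_1>0$ and the known bound $\eta>0$ on the obstacle speed let $$\phi_{x,1}=L_{f_p}b_x-\tfrac1{4k}\Big\|\tfrac{\partial b_x}{\partial x_o}\Big\|^2-k\eta^2+p_1b_x,\qquad \breve\beta_1=L_{g_p}\phi_{x,1},\qquad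 \breve\beta_2=L_{g_p}b_v .$$ Let $V^\star$ be a $C^1$ positive definite solution of the Hamilton–Jacobi–Isaacs equation $$\min_{u_n}\max_{u_e}\big\{\ell(\xi,u_n,u_e)+\nabla V^{\star\top}(\mathcal F+g_pu_n-g_eu_e)\big\}=0 ,$$ let $\Omega_p,\Omega_e,\Omega\subset\mathbb R^{2n}$ be compact with $\Omega_p-\Omega_e\subset\Omega$, let $\vartheta:\mathbb R^{2n}\to\mathbb R^{l}$ be $C^1$, and on $\Omega$ let $V^\star=W^\top\vartheta+\epsilon_c$ and $\nabla V^\star=\nabla\vartheta^\top W+\nabla\epsilon_c$ with $\epsilon_c\in C^1$ and an ideal weight $W\in\mathbb R^l$ (here $\nabla\vartheta$ is the $l\times 2n$ Jacobian). **Controller.** The pursuer uses $u_p=\hat u_n+u_r+u_s$ with $$\hat u_n=-\tfrac12R^{-1}g_p^\top\nabla\vartheta^\top\hat W_a,\qquad u_r=-\mathcal K\tanh\!\big(g_p^\top\chi^\top s/r\big),\qquad u_s=-\tilde K_xB_x'(\phi_{x,1})\,\breve\beta_1^\top-\tilde K_vB_v'(b_v)\,\breve\beta_2^\top ,$$ where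 $r,\tilde K_x,\tilde K_v>0$, and $B_x,B_v$ are $C^1$ on $(0,\infty)$ and satisfy $1/\alpha_1\le B\le1/\alpha_2$ on $(0,\infty)$ for some class $\mathcal K$ functions $\alpha_1,\alpha_2$; $S:\mathbb R^{2n}\to\mathbb R^m$ is $C^1$, $\chi=\partial S/\partial z_p$, and $$s(t)=S(z_p(t))-S(z_p(0))-\int_0^t\chi(z_p)\big(f_p(z_p)+g_p(z_p)(u_s+\hat u_n)\big)d\tau .$$ The gain $\mathcal K$ obeys $\dot{\mathcal K}=K_1+K_2\|s\|$ while $\|s\|>\varepsilon$, and $\mathcal K=K_3+\mathcal K(t^*)\|\theta\|$, $K_4\dot\theta+\theta=\operatorname{sign}(s)$ while $\|s\|\le\varepsilon$, where $\mathcal K(t^*)$ is the gain with which the region $\|s\|\le\varepsilon$ was last entered (a given initial gain $\mathcal K_0>0$ before the first entry); $K_1,\dots,K_4,\varepsilon>0$. **Learning laws.** Let $\hat u_e=-\frac1{2\gamma^2}T^{-1}g_e^\top\nabla\vartheta^\top\hat W_p$, $\varphi=\nabla\vartheta(\xi)(\mathcal F+g_p\hat u_n-g_e\hat u_e)$, $\rho=1+\varphi^\top\varphi$,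 $\delta=\hat W_c^\top\varphi+\ell(\xi,\hat u_n,\hat u_e)$, $\Lambda=\varphi\varphi^\top/\rho^2$, $\mathcal G_\vartheta=\nabla\vartheta g_pR^{-1}g_p^\top\nabla\vartheta^\top$, $\mathcal H_\vartheta=\nabla\vartheta g_eT^{-1}g_e^\top\nabla\vartheta^\top$, and let $\varphi_i,\rho_i,\delta_i,\Lambda_i,\mathcal G_{\vartheta,i},\mathcal H_{\vartheta,i}$ be the same quantities at simulated states $(z_p^i(t),z_e^i(t))\in\Omega_p\times\Omega_e$, $\xi_i=z_p^i-z_e^i$, $i=1,\dots,N$. With positive gains and $\Gamma(0)=\Gamma_0\succ0$, $$\dot{\hat W}_c=-\Gamma\Big(k_{c1}\tfrac{\varphi}{\rho^2}\delta+\tfrac{k_{c2}}N\sum_i\tfrac{\varphi_i}{\rho_i^2}\delta_i\Big),\qquad \dot\Gamma=\beta\Gamma-\Gamma\Big(k_{c1}\Lambda+\tfrac{k_{c2}}N\sum_i\Lambda_i\Big)\Gamma ,$$ $$\dot{\hat W}_a=\operatorname{Proj}\Big\{-k_{a1}(\hat W_a-\hat W_c)-k_{a2}\hat W_a+\tfrac{k_{c1}}4\mathcal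 G_\vartheta\hat W_a\tfrac{\varphi^\top}{\rho^2}\hat W_c+\tfrac{k_{c2}}{4N}\sum_i\mathcal G_{\vartheta,i}\hat W_a\tfrac{\varphi_i^\top}{\rho_i^2}\hat W_c\Big\},$$ $$\dot{\hat W}_p=\operatorname{Proj}\Big\{-k_{p1}(\hat W_p-\hat W_c)-k_{p2}\hat W_p-\tfrac{k_{c1}}{4\gamma^2}\mathcal H_\vartheta\hat W_p\tfrac{\varphi^\top}{\rho^2}\hat W_c-\tfrac{k_{c2}}{4N\gamma^2}\sum_i\mathcal H_{\vartheta,i}\hat W_p\tfrac{\varphi_i^\top}{\rho_i^2}\hat W_c\Big\}.$$ Here $\operatorname{Proj}$ is the smooth projection onto a compact set $\mathcal W=\{h\le1\}$, where $h$ is a convex $C^1$ function with $\{h\le0\}\ne\emptyset$: at the estimate $\theta$, $\operatorname{Proj}\{y\}=y-h(\theta)\frac{\nabla h(\theta)\nabla h(\theta)^\top}{\|\nabla h(\theta)\|^2}y$ if $h(\theta)>0$ and $\nabla h(\theta)^\top y>0$, and $\operatorname{Proj}\{y\}=y$ otherwise; $\hat W_a(0),\hat W_p(0)\in\mathcal W$.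 **Assumptions.** Fix $\bar d,\bar u_e,\lambda_c>0$. (1) $\|d(t)\|\le\bar d$ for all $t\ge0$. (2) $x_o$ is bounded and differentiable with $\|\dot x_o\|\le\eta$. (3) $z_e(t)\in\Omega_e$ for all $t\ge 0$, $u_e\in L_2$ and $\|u_e(t)\|\le\bar u_e$. (4) The smallest eigenvalue of $\frac1N\sum_{i=1}^N\Lambda_i(t)$ is at least $\lambda_c$ for all $t\ge0$. Moreover $z_p(t)\in\Omega_p$ for all $t\ge0$, and the initial state is safe: $b_x(z_p(0),x_o(0))>0$ and $b_v(z_p(0))>0$. **Theorem.** The closed-loop state $z=\operatorname{col}(\xi,\tilde W_c,\tilde W_a,\tilde W_p)$, with $\tilde W_c=W-\hat W_c$, $\tilde W_a=W-\hat W_a$, $\tilde W_p=W-\hat W_p$, is uniformly ultimately bounded: there is $b>0$ such that for every $a>0$ there is $T\ge0$ such that, for every closed-loop trajectory on $[0,\infty)$ satisfying the assumptions above and every $t_0\ge0$, if $\|z(t_0)\|\le a$ then $\|z(t)\|\le b$ for all $t\ge t_0+T$. -/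

import Mathlib

open MeasureTheory Set Filter Topology
open scoped InnerProductSpace

noncomputable section

/-! ## Spaces and general notions -/

/-- `ℝᵏ` with the Euclidean norm. -/
abbrev Vec (k : ℕ) : Type := EuclideanSpace ℝ (Fin k)

/-- `ℝ²ⁿ`, the space of the states `col(x, v)`: position in the left block, velocity in the right. -/
abbrev State (n : ℕ) : Type := EuclideanSpace ℝ (Fin n ⊕ Fin n)

/-- The linear map of a square matrix on Euclidean space. -/
abbrev Matrix.op {p : ℕ} (A : Matrix (Fin p) (Fin p) ℝ) : Vec p →L[ℝ] Vec p :=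
  Matrix.toEuclideanCLM (n := Fin p) (𝕜 := ℝ) A

/-- `x` solves `ẋ(t) = v(t)` on `[0, ∞)` in the sense of Carathéodory: `x` is the integral of the
locally integrable function `v`.  (Inputs and disturbances are only measurable in time.) -/
def SolvesODE {E : Type*} [NormedAddCommGroup E] [NormedSpace ℝ E] (x v : ℝ → E) : Prop :=
  (∀ t, 0 ≤ t → IntervalIntegrable v volume 0 t) ∧
    ∀ t, 0 ≤ t → x t = x 0 + ∫ τ in (0 : ℝ)..t, v τ

/-- Class `𝒦` functions (on `[0, ∞)`). -/
def ClassK (α : ℝ → ℝ) : Prop :=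
  ContinuousOn α (Ici 0) ∧ StrictMonoOn α (Ici 0) ∧ α 0 = 0

/-- A barrier (energy) function on `(0, ∞)`: continuously differentiable, with reciprocal
sandwiched between two class `𝒦` functions. -/
def IsBarrier (B : ℝ → ℝ) : Prop :=
  ContDiffOn ℝ 1 B (Ioi 0) ∧
    ∃ α₁ α₂ : ℝ → ℝ, ClassK α₁ ∧ ClassK α₂ ∧ ∀ r, 0 < r → 1 / α₁ r ≤ B r ∧ B r ≤ 1 / α₂ r

/-- Lie derivative `L_f b` along a vector field. -/
def lieF {E : Type*} [NormedAddCommGroup E] [NormedSpace ℝ E]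
    (f : E → E) (b : E → ℝ) (z : E) : ℝ :=
  fderiv ℝ b z (f z)

/-- Lie derivative `L_g b` along the columns of `g`: a row vector, i.e. a linear form. -/
def lieG {E U : Type*} [NormedAddCommGroup E] [NormedSpace ℝ E]
    [NormedAddCommGroup U] [NormedSpace ℝ U]
    (g : E → U →L[ℝ] E) (b : E → ℝ) (z : E) : U →L[ℝ] ℝ :=
  (fderiv ℝ b z).comp (g z)

/-- `b` has relative degree `m` on `C` for `ż = f(z) + g(z) u`. -/
def HasRelativeDegree {E U : Type*} [NormedAddCommGroup E] [NormedSpace ℝ E]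
    [NormedAddCommGroup U] [NormedSpace ℝ U]
    (f : E → E) (g : E → U →L[ℝ] E) (b : E → ℝ) (C : Set E) (m : ℕ) : Prop :=
  1 ≤ m ∧ ∀ z ∈ C, (∀ k, k + 2 ≤ m → lieG g ((lieF f)^[k] b) z = 0) ∧
    lieG g ((lieF f)^[m - 1] b) z ≠ 0

/-- A family of trajectories on `[0, ∞)` is uniformly ultimately bounded: there is one ultimate
bound `b` such that for every (arbitrarily large) `a` there is a time `T`, depending only on `a`
and `b`, after which each trajectory that is `a`-bounded at some time `t₀` stays `b`-bounded. -/
def UniformlyUltimatelyBounded {E : Type*} [Norm E] (F : Set (ℝ → E)) : Prop :=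
  ∃ b : ℝ, 0 < b ∧ ∀ a : ℝ, 0 < a → ∃ T : ℝ, 0 ≤ T ∧
    ∀ z ∈ F, ∀ t₀ : ℝ, 0 ≤ t₀ → ‖z t₀‖ ≤ a → ∀ t : ℝ, t₀ + T ≤ t → ‖z t‖ ≤ b

/-- The smooth projection operator `Proj{y}` at the estimate `θ`, for the set `{h ≤ 1}`: inside
`{h ≤ 0}`, and for inward directions `y`, it is `y`; in the layer `0 < h ≤ 1` the outward normal
component of `y` is scaled by `1 - h(θ)`. -/
def smoothProj {E : Type*} [NormedAddCommGroup E] [InnerProductSpace ℝ E] [CompleteSpace E]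
    (h : E → ℝ) (θ y : E) : E :=
  open Classical in
  if 0 < h θ ∧ 0 < ⟪gradient h θ, y⟫_ℝ then
    y - (h θ * ⟪gradient h θ, y⟫_ℝ / ‖gradient h θ‖ ^ 2) • gradient h θ
  else y

/-! ## The pursuit-evasion game -/

/-- Data of the game, with standing regularity. -/
structure PEGame (n p : ℕ) where
  /-- pursuer dynamics `ż_p = f_p(z_p) + g_p(z_p)(u_p + d)` -/
  fp : State n → State n
  gp : State n → Vec p →L[ℝ] State n
  /-- evader dynamics `ż_e = f_e(z_e) + g_e(z_e) u_e` -/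
  fe : State n → State n
  ge : State n → Vec p →L[ℝ] State n
  /-- reward `l = Q(ξ) + u_nᵀ R u_n - γ² u_eᵀ T u_e` -/
  Q : State n → ℝ
  R : Matrix (Fin p) (Fin p) ℝ
  T : Matrix (Fin p) (Fin p) ℝ
  γ : ℝ
  /-- position constraint `b_x(z_p, x_o) ≥ 0` and velocity constraint `b_v(z_p) ≥ 0` -/
  bx : State n → Vec n → ℝ
  bv : State n → ℝ
  /-- known bound on the speed of the obstacle -/
  η : ℝ
  fp_lip : LocallyLipschitz fp
  gp_lip : LocallyLipschitz gp
  fe_lip : LocallyLipschitz fe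
  ge_lip : LocallyLipschitz ge
  fp_zero : fp 0 = 0
  /-- full column rank -/
  gp_inj : ∀ z, Function.Injective (gp z)
  Q_cont : Continuous Q
  Q_zero : Q 0 = 0
  Q_pos : ∀ ξ, ξ ≠ 0 → 0 < Q ξ
  R_pos : R.PosDef
  T_pos : T.PosDef
  γ_pos : 0 < γ
  η_pos : 0 < η
  bx_smooth : ContDiff ℝ 2 (Function.uncurry bx)
  Lbx_smooth : ContDiff ℝ 1 (Function.uncurry fun z x => lieF fp (fun z' => bx z' x) z)
  bv_smooth : ContDiff ℝ 1 bv
  bx_degree : ∀ x, HasRelativeDegree fp gp (fun z => bx z x) {z | 0 ≤ bx z x} 2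
  bv_degree : HasRelativeDegree fp gp bv {z | 0 ≤ bv z} 1

namespace PEGame

variable {n p : ℕ} (G : PEGame n p)

/-- `𝓕(z_p, z_e) = f_p(z_p) - f_e(z_e)` -/
def drift (zp ze : State n) : State n := G.fp zp - G.fe ze

/-- reward function -/
def reward (ξ : State n) (un ue : Vec p) : ℝ :=
  G.Q ξ + ⟪un, G.R.op un⟫_ℝ - G.γ ^ 2 * ⟪ue, G.T.op ue⟫_ℝ

/-- Hamiltonian at `ξ = z_p - z_e` and costate `q` -/
def hamiltonian (zp ze q : State n) (un ue : Vec p) : ℝ :=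
  G.reward (zp - ze) un ue + ⟪q, G.drift zp ze + G.gp zp un - G.ge ze ue⟫_ℝ

/-- `V` is a continuously differentiable positive definite solution of the Hamilton-Jacobi-Isaacs
equation `min_{u_n} max_{u_e} H(ξ, ∇V, u_n, u_e) = 0`. -/
def IsOptimalValue (V : State n → ℝ) : Prop :=
  ContDiff ℝ 1 V ∧ V 0 = 0 ∧ (∀ ξ, ξ ≠ 0 → 0 < V ξ) ∧
    ∀ zp ze : State n,
      IsLeast {M : ℝ | ∃ un : Vec p,
        IsGreatest (range fun ue : Vec p => G.hamiltonian zp ze (gradient V (zp - ze)) un ue) M} 0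

/-- `φ_{x,0} = b_x` -/
def phi0 (z : State n) (x : Vec n) : ℝ := G.bx z x

/-- `b̃_x = L_{f_p} b_x - ‖∂b_x/∂x_o‖² / (4k) - k η²` -/
def bxTilde (k : ℝ) (z : State n) (x : Vec n) : ℝ :=
  lieF G.fp (fun z' => G.bx z' x) z - 1 / (4 * k) * ‖gradient (fun x' => G.bx z x') x‖ ^ 2
    - k * G.η ^ 2

/-- `φ_{x,1} = b̃_x + p₁ φ_{x,0}` -/
def phi1 (k p₁ : ℝ) (z : State n) (x : Vec n) : ℝ := G.bxTilde k z x + p₁ * G.phi0 z x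

end PEGame

/-! ## Design of the learning controller -/

/-- Design parameters of the pursuer: `m` components of the sliding variable, `l` neurons. -/
structure Design {n p : ℕ} (G : PEGame n p) (m l : ℕ) where
  /-- safeguard: constants in `φ_{x,1}`, energy functions and safe control gains -/
  k : ℝ
  p₁ : ℝ
  Bx : ℝ → ℝ
  Bv : ℝ → ℝ
  Kx : ℝ
  Kv : ℝ
  /-- sliding mode: surface function, adaptation constants, initial adaptive gain,
  threshold, and slope of the hyperbolic tangent -/
  S : State n → Vec m
  K₁ : ℝ
  K₂ : ℝ
  K₃ : ℝ
  K₄ : ℝ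
  Kinit : ℝ
  ε : ℝ
  r : ℝ
  /-- neural networks: activation function, learning gains, forgetting factor, initial gain matrix,
  and the function whose sublevel set `{h ≤ 1}` is the projection set -/
  ϑ : State n → Vec l
  kc₁ : ℝ
  kc₂ : ℝ
  ka₁ : ℝ
  ka₂ : ℝ
  kp₁ : ℝ
  kp₂ : ℝ
  β : ℝ
  Γinit : Matrix (Fin l) (Fin l) ℝ
  h : Vec l → ℝ
  k_pos : 0 < k
  p₁_pos : 0 < p₁
  Bx_barrier : IsBarrier Bx
  Bv_barrier : IsBarrier Bv
  Kx_pos : 0 < Kx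
  Kv_pos : 0 < Kv
  S_smooth : ContDiff ℝ 1 S
  K₁_pos : 0 < K₁
  K₂_pos : 0 < K₂
  K₃_pos : 0 < K₃
  K₄_pos : 0 < K₄
  Kinit_pos : 0 < Kinit
  ε_pos : 0 < ε
  r_pos : 0 < r
  ϑ_smooth : ContDiff ℝ 1 ϑ
  kc₁_pos : 0 < kc₁
  kc₂_pos : 0 < kc₂
  ka₁_pos : 0 < ka₁
  ka₂_pos : 0 < ka₂
  kp₁_pos : 0 < kp₁
  kp₂_pos : 0 < kp₂
  β_pos : 0 < β
  Γinit_pos : Γinit.PosDef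
  h_smooth : ContDiff ℝ 1 h
  h_convex : ConvexOn ℝ univ h
  h_compact : IsCompact {w | h w ≤ 1}
  h_nonempty : {w | h w ≤ 0}.Nonempty

/-- The signals of the closed loop, as functions of time; `N` is the number of simulated samples. -/
structure Signals (n p m l N : ℕ) where
  /-- disturbance, evader's input, obstacle position -/
  d : ℝ → Vec p
  ue : ℝ → Vec p
  xo : ℝ → Vec n
  /-- pursuer's and evader's states -/
  zp : ℝ → State n
  ze : ℝ → State n
  /-- sampled states -/
  zps : Fin N → ℝ → State n
  zes : Fin N → ℝ → State n
  /-- critic, least-squares gain, actor, perturber -/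
  Wc : ℝ → Vec l
  Γ : ℝ → Vec l →L[ℝ] Vec l
  Wa : ℝ → Vec l
  Wp : ℝ → Vec l
  /-- adaptive sliding mode gain and its filter state -/
  K : ℝ → ℝ
  θ : ℝ → Vec m

/-- Relative state `ξ = z_p - z_e`. -/
def Signals.ξ {n p m l N : ℕ} (σ : Signals n p m l N) (t : ℝ) : State n := σ.zp t - σ.ze t

/-- `z = col(ξ, W̃_c, W̃_a, W̃_p)` with `W̃ = W - Ŵ`. -/
def Signals.errorState {n p m l N : ℕ} (σ : Signals n p m l N) (W : Vec l) (t : ℝ) :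
    EuclideanSpace ℝ ((Fin n ⊕ Fin n) ⊕ Fin l ⊕ Fin l ⊕ Fin l) :=
  WithLp.toLp 2 (Sum.elim (σ.ξ t) (Sum.elim (W - σ.Wc t) (Sum.elim (W - σ.Wa t) (W - σ.Wp t))))

namespace Design

open ContinuousLinearMap (adjoint)

variable {n p m l N : ℕ} {G : PEGame n p} (D : Design G m l)

/-! ### Neural network policies and regressors -/

/-- actor `û_n = -½ R⁻¹ g_pᵀ ∇ϑᵀ Ŵ_a` -/
def unHat (zp ξ : State n) (wa : Vec l) : Vec p :=
  (-(1 / 2 : ℝ)) • (G.R⁻¹).op (adjoint (G.gp zp) (adjoint (fderiv ℝ D.ϑ ξ) wa))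

/-- perturber `û_e = -(1 / 2γ²) T⁻¹ g_eᵀ ∇ϑᵀ Ŵ_p` -/
def ueHat (ze ξ : State n) (wp : Vec l) : Vec p :=
  (-(1 / (2 * G.γ ^ 2))) • (G.T⁻¹).op (adjoint (G.ge ze) (adjoint (fderiv ℝ D.ϑ ξ) wp))

/-- regressor `φ = ∇ϑ (𝓕 + g_p û_n - g_e û_e)` at the state `(z_p, z_e)`, `ξ = z_p - z_e` -/
def regressor (zp ze : State n) (wa wp : Vec l) : Vec l :=
  fderiv ℝ D.ϑ (zp - ze)
    (G.drift zp ze + G.gp zp (D.unHat zp (zp - ze) wa) - G.ge ze (D.ueHat ze (zp - ze) wp))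

/-- Bellman error `δ = Ŵ_cᵀ φ + l(ξ, û_n, û_e)` -/
def bellmanError (zp ze : State n) (wc wa wp : Vec l) : ℝ :=
  ⟪wc, D.regressor zp ze wa wp⟫_ℝ +
    G.reward (zp - ze) (D.unHat zp (zp - ze) wa) (D.ueHat ze (zp - ze) wp)

/-- normalized regressor `φ / ρ²`, with `ρ = 1 + φᵀ φ` -/
def normalized (φ : Vec l) : Vec l := (1 / (1 + ⟪φ, φ⟫_ℝ) ^ 2) • φ

/-- `Λ = φ φᵀ / ρ²` -/
def Lam (φ : Vec l) : Vec l →L[ℝ] Vec l :=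
  (1 / (1 + ⟪φ, φ⟫_ℝ) ^ 2) • InnerProductSpace.rankOne ℝ φ φ

/-- `𝒢_ϑ = ∇ϑ g_p R⁻¹ g_pᵀ ∇ϑᵀ` -/
def Gmat (zp ξ : State n) : Vec l →L[ℝ] Vec l :=
  fderiv ℝ D.ϑ ξ ∘L G.gp zp ∘L (G.R⁻¹).op ∘L adjoint (G.gp zp) ∘L adjoint (fderiv ℝ D.ϑ ξ)

/-- `ℋ_ϑ = ∇ϑ g_e T⁻¹ g_eᵀ ∇ϑᵀ` -/
def Hmat (ze ξ : State n) : Vec l →L[ℝ] Vec l :=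
  fderiv ℝ D.ϑ ξ ∘L G.ge ze ∘L (G.T⁻¹).op ∘L adjoint (G.ge ze) ∘L adjoint (fderiv ℝ D.ϑ ξ)

/-! ### Signals along a trajectory -/

variable (σ : Signals n p m l N)

/-- `φ(t)` -/
def φ (t : ℝ) : Vec l := D.regressor (σ.zp t) (σ.ze t) (σ.Wa t) (σ.Wp t)

/-- `φ_i(t)` -/
def φs (i : Fin N) (t : ℝ) : Vec l := D.regressor (σ.zps i t) (σ.zes i t) (σ.Wa t) (σ.Wp t)

/-- `δ(t)` -/
def δ (t : ℝ) : ℝ := D.bellmanError (σ.zp t) (σ.ze t) (σ.Wc t) (σ.Wa t) (σ.Wp t)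

/-- `δ_i(t)` -/
def δs (i : Fin N) (t : ℝ) : ℝ :=
  D.bellmanError (σ.zps i t) (σ.zes i t) (σ.Wc t) (σ.Wa t) (σ.Wp t)

/-- `(1/N) ∑ Λ_i(t)` -/
def avgLam (t : ℝ) : Vec l →L[ℝ] Vec l := (1 / (N : ℝ)) • ∑ i, Lam (D.φs σ i t)

/-- right-hand side of the critic law -/
def criticRate (t : ℝ) : Vec l :=
  -(σ.Γ t ((D.kc₁ * D.δ σ t) • normalized (D.φ σ t) +
    (D.kc₂ / N) • ∑ i, D.δs σ i t • normalized (D.φs σ i t)))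

/-- right-hand side of the law of the least-squares gain -/
def gainRate (t : ℝ) : Vec l →L[ℝ] Vec l :=
  D.β • σ.Γ t -
    σ.Γ t ∘L (D.kc₁ • Lam (D.φ σ t) + D.kc₂ • D.avgLam σ t) ∘L σ.Γ t

/-- right-hand side of the actor law -/
def actorRate (t : ℝ) : Vec l :=
  smoothProj D.h (σ.Wa t)
    (-(D.ka₁ • (σ.Wa t - σ.Wc t)) - D.ka₂ • σ.Wa t
      + (D.kc₁ / 4 * ⟪normalized (D.φ σ t), σ.Wc t⟫_ℝ) • D.Gmat (σ.zp t) (σ.ξ t) (σ.Wa t)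
      + (D.kc₂ / (4 * N)) • ∑ i, ⟪normalized (D.φs σ i t), σ.Wc t⟫_ℝ •
          D.Gmat (σ.zps i t) (σ.zps i t - σ.zes i t) (σ.Wa t))

/-- right-hand side of the perturber law -/
def perturberRate (t : ℝ) : Vec l :=
  smoothProj D.h (σ.Wp t)
    (-(D.kp₁ • (σ.Wp t - σ.Wc t)) - D.kp₂ • σ.Wp t
      - (D.kc₁ / (4 * G.γ ^ 2) * ⟪normalized (D.φ σ t), σ.Wc t⟫_ℝ) •
          D.Hmat (σ.ze t) (σ.ξ t) (σ.Wp t)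
      - (D.kc₂ / (4 * N * G.γ ^ 2)) • ∑ i, ⟪normalized (D.φs σ i t), σ.Wc t⟫_ℝ •
          D.Hmat (σ.zes i t) (σ.zps i t - σ.zes i t) (σ.Wp t))

/-! ### The three control terms -/

/-- learned nominal control -/
def un (t : ℝ) : Vec p := D.unHat (σ.zp t) (σ.ξ t) (σ.Wa t)

/-- `φ_{x,1}` along the trajectory, as a function of `z_p` at time `t` -/
def barrierArg (t : ℝ) (z : State n) : ℝ := G.phi1 D.k D.p₁ z (σ.xo t)

/-- safeguard `u_s = ζ_x β̆₁ᵀ + ζ_v β̆₂ᵀ`, where `β̆₁ = L_{g_p} φ_{x,1}`, `β̆₂ = L_{g_p} b_v`,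
`ζ_x = -K̃_x B_x'(φ_{x,1})` and `ζ_v = -K̃_v B_v'(b_v)` -/
def us (t : ℝ) : Vec p :=
  (-(D.Kx * deriv D.Bx (D.barrierArg σ t (σ.zp t)))) •
      (InnerProductSpace.toDual ℝ (Vec p)).symm (lieG G.gp (D.barrierArg σ t) (σ.zp t)) +
    (-(D.Kv * deriv D.Bv (G.bv (σ.zp t)))) •
      (InnerProductSpace.toDual ℝ (Vec p)).symm (lieG G.gp G.bv (σ.zp t))

/-- integrand `χ(z_p)(f_p(z_p) + g_p(z_p)(u_s + û_n))` of the sliding variable, `χ = ∂S/∂z_p` -/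
def slidingIntegrand (t : ℝ) : Vec m :=
  fderiv ℝ D.S (σ.zp t) (G.fp (σ.zp t) + G.gp (σ.zp t) (D.us σ t + D.un σ t))

/-- integral sliding variable -/
def s (t : ℝ) : Vec m :=
  D.S (σ.zp t) - D.S (σ.zp 0) - ∫ τ in (0 : ℝ)..t, D.slidingIntegrand σ τ

/-- robust control `u_r = -𝒦 tanh(g_pᵀ χᵀ s / ρ)`, with `tanh` componentwise -/
def ur (t : ℝ) : Vec p :=
  (-(σ.K t)) • WithLp.toLp 2 fun j =>
    Real.tanh ((adjoint (G.gp (σ.zp t)) (adjoint (fderiv ℝ D.S (σ.zp t)) (D.s σ t))) j / D.r)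

/-- pursuer's input `u_p = û_n + u_r + u_s` -/
def up (t : ℝ) : Vec p := D.un σ t + D.ur σ t + D.us σ t

/-- `t` is a time at which the sliding variable enters the tube `‖s‖ ≤ ε` -/
def IsEntryTime (t : ℝ) : Prop :=
  0 < t ∧ ‖D.s σ t‖ ≤ D.ε ∧ ∀ᶠ τ in 𝓝[<] t, D.ε < ‖D.s σ τ‖

/-- The adaptation law of the gain `𝒦`.  Outside the tube `𝒦` grows at the rate `K₁ + K₂ ‖s‖`
(continuously from its value at the exit).  Inside the tube `𝒦 = K₃ + 𝒦(t*) ‖θ‖`, where `𝒦(t*)`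
is the gain with which the tube was last entered (the initial gain before the first entry) and
`K₄ θ̇ + θ = sign(s)` for almost every time. -/
structure GainLaw : Prop where
  grow : ∀ t, 0 < t → D.ε < ‖D.s σ t‖ → HasDerivAt σ.K (D.K₁ + D.K₂ * ‖D.s σ t‖) t
  exit : ∀ t, 0 ≤ t → ‖D.s σ t‖ ≤ D.ε → (∀ᶠ τ in 𝓝[>] t, D.ε < ‖D.s σ τ‖) →
    ContinuousWithinAt σ.K (Ici t) t
  hold_first : ∀ t, 0 ≤ t → ‖D.s σ t‖ ≤ D.ε → (∀ τ ≤ t, ¬ D.IsEntryTime σ τ) →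
    σ.K t = D.K₃ + D.Kinit * ‖σ.θ t‖
  hold : ∀ t, 0 ≤ t → ‖D.s σ t‖ ≤ D.ε →
    ∀ tstar, IsGreatest {τ | τ ≤ t ∧ D.IsEntryTime σ τ} tstar →
    ∃ Kstar, Tendsto σ.K (𝓝[<] tstar) (𝓝 Kstar) ∧ σ.K t = D.K₃ + Kstar * ‖σ.θ t‖
  filter : ∀ t₁ t₂, 0 ≤ t₁ → t₁ ≤ t₂ → (∀ τ ∈ Icc t₁ t₂, ‖D.s σ τ‖ ≤ D.ε) →
    IntervalIntegrable σ.θ volume t₁ t₂ ∧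
    σ.θ t₂ = σ.θ t₁ + ∫ τ in t₁..t₂,
      (1 / D.K₄) • (WithLp.toLp 2 (fun j => Real.sign (D.s σ τ j)) - σ.θ τ)

/-- The signals form a trajectory of the closed loop on `[0, ∞)`. -/
structure ClosedLoop : Prop where
  pursuer : SolvesODE σ.zp fun t =>
    G.fp (σ.zp t) + G.gp (σ.zp t) (D.up σ t + σ.d t)
  evader : SolvesODE σ.ze fun t => G.fe (σ.ze t) + G.ge (σ.ze t) (σ.ue t)
  sliding : ∀ t, 0 ≤ t → IntervalIntegrable (D.slidingIntegrand σ) volume 0 t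
  gain : D.GainLaw σ
  critic : SolvesODE σ.Wc (D.criticRate σ)
  leastSquares : SolvesODE σ.Γ (D.gainRate σ)
  actor : SolvesODE σ.Wa (D.actorRate σ)
  perturber : SolvesODE σ.Wp (D.perturberRate σ)
  Γ_init : σ.Γ 0 = D.Γinit.op
  Wa_init : D.h (σ.Wa 0) ≤ 1
  Wp_init : D.h (σ.Wp 0) ≤ 1

/-- Sampling rank condition: the smallest eigenvalue of `(1/N) ∑ Λ_i(t)` is at least `lamc` at all
times `t ≥ 0`. -/
def SamplingRank (lamc : ℝ) : Prop :=
  ∀ t, 0 ≤ t → ∀ μ : ℝ,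
    Module.End.HasEigenvalue (D.avgLam σ t : Vec l →ₗ[ℝ] Vec l) μ → lamc ≤ μ

end Design

namespace Signals

variable {n p m l N : ℕ} (σ : Signals n p m l N)

/-- The disturbance is bounded by `dbar`. -/
def DisturbanceBound (dbar : ℝ) : Prop :=
  AEStronglyMeasurable σ.d (volume.restrict (Ici 0)) ∧ ∀ t, 0 ≤ t → ‖σ.d t‖ ≤ dbar

/-- The obstacle's position is bounded and its speed is at most `η`. -/
def ObstacleBound (η : ℝ) : Prop :=
  (∃ M, ∀ t, 0 ≤ t → ‖σ.xo t‖ ≤ M) ∧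
    ∀ t, 0 ≤ t → ∃ v, HasDerivWithinAt σ.xo v (Ici 0) t ∧ ‖v‖ ≤ η

/-- The evader's state stays in `Ωe`, its input is in `L₂ ∩ L_∞` and bounded by `uebar`. -/
def EvaderBound (Ωe : Set (State n)) (uebar : ℝ) : Prop :=
  (∀ t, 0 ≤ t → σ.ze t ∈ Ωe) ∧ MemLp σ.ue 2 (volume.restrict (Ici 0)) ∧
    ∀ t, 0 ≤ t → ‖σ.ue t‖ ≤ uebar

/-- The simulated samples are taken (measurably in time) in `Ωp × Ωe`. -/
def SamplesIn (Ωp Ωe : Set (State n)) : Prop :=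
  ∀ i, AEStronglyMeasurable (σ.zps i) (volume.restrict (Ici 0)) ∧
    AEStronglyMeasurable (σ.zes i) (volume.restrict (Ici 0)) ∧
    ∀ t, 0 ≤ t → σ.zps i t ∈ Ωp ∧ σ.zes i t ∈ Ωe

end Signals

end

/-! ## Calculus of Carathéodory solutions -/

section Caratheodory

variable {E F H : Type*} [NormedAddCommGroup E] [NormedSpace ℝ E]
  [NormedAddCommGroup F] [NormedSpace ℝ F] [NormedAddCommGroup H] [NormedSpace ℝ H]

/-! Three of the four blocks of the error state are bounded at all times: ξ lies in the compact set
Ω, and the projection keeps the actor and perturber weights in {h ≤ 1}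
(`SolvesODE.smoothProj_invariant`). Only the critic needs a dynamical argument.

The regressors do not involve Ŵ_c and the Bellman error is affine in it, so the critic law reads ẇ =
-Γ(A w + c) (`criticRate_eq`). The excitation A is bounded because of the normalization and coercive
because of the sampling rank condition. The forcing c is bounded because the reward of the learned
policies is continuous on a compact set.

Formally e^{βt}Γ⁻¹ is M(t) = Γ₀⁻¹ + ∫₀ᵗ e^{βτ}A dτ, and then (M w)' = -e^{βt}c: the excitation
cancels. Both ‖M(t)‖ and the coercivity constant of M(t) are of order e^{βt}, so w(t) is bounded by
a multiple of e^{-β(t-s)}‖w(s)‖ plus a constant (`leastSquares_norm_le`). The constants are the same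
for all trajectories, which gives the uniformity.

Since inputs and samples are only measurable in time, the chain rule, the product rule and
uniqueness are proved for integral solutions, through absolute continuity. -/

theorem AbsolutelyContinuousOnInterval.of_dist_le {X Y : Type*} [PseudoMetricSpace X]
    [PseudoMetricSpace Y] {f : ℝ → X} {g : ℝ → Y} {a b C : ℝ}
    (hg : AbsolutelyContinuousOnInterval g a b)
    (h : ∀ x ∈ uIcc a b, ∀ y ∈ uIcc a b, dist (f x) (f y) ≤ C * dist (g x) (g y)) :
    AbsolutelyContinuousOnInterval f a b := by
  rw [absolutelyContinuousOnInterval_iff] at hg ⊢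
  intro ε hε
  -- `C` has no assumed sign; `|C| + 1` is positive and dominates it.
  obtain ⟨δ, hδ, H⟩ := hg (ε / (|C| + 1)) (by positivity)
  refine ⟨δ, hδ, fun I hI hlen => ?_⟩
  have h1 := H I hI hlen
  rw [lt_div_iff₀ (by positivity), Finset.sum_mul] at h1
  refine lt_of_le_of_lt (Finset.sum_le_sum fun i hi => ?_) h1
  obtain ⟨hx, hy⟩ := hI.1 i hi
  refine (h _ hx _ hy).trans ?_
  rw [mul_comm]
  gcongr
  linarith [le_abs_self C]

namespace SolvesODE

theorem sub_eq_integral {x v : ℝ → E} (h : SolvesODE x v) {s t : ℝ} (hs : 0 ≤ s) (ht : 0 ≤ t) :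
    x t - x s = ∫ τ in s..t, v τ := by
  rw [h.2 t ht, h.2 s hs, add_sub_add_left_eq_sub,
    intervalIntegral.integral_interval_sub_left (h.1 t ht) (h.1 s hs)]

/-- Increments of x are dominated by those of the primitive of ‖v‖, which is absolutely continuous.
-/
theorem absolutelyContinuousOnInterval {x v : ℝ → E} (h : SolvesODE x v) {t : ℝ} (ht : 0 ≤ t) :
    AbsolutelyContinuousOnInterval x 0 t := by
  have hn : IntervalIntegrable (fun τ => ‖v τ‖) volume 0 t := (h.1 t ht).norm
  refine (hn.absolutelyContinuousOnInterval_intervalIntegral (c := 0) left_mem_uIcc).of_dist_le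
    (C := 1) ?_
  rw [uIcc_of_le ht]
  intro a ha b hb
  have hI : ∀ {c}, c ∈ Icc 0 t → IntervalIntegrable (fun τ => ‖v τ‖) volume 0 c :=
    fun hc => (h.1 _ hc.1).norm
  rw [dist_eq_norm, dist_eq_norm, h.sub_eq_integral hb.1 ha.1, one_mul,
    intervalIntegral.integral_interval_sub_left (hI ha) (hI hb)]
  exact intervalIntegral.norm_integral_le_abs_integral_norm

theorem continuousOn {x v : ℝ → E} (h : SolvesODE x v) : ContinuousOn x (Ici 0) := by
  intro t ht
  have h1 : (0 : ℝ) ≤ t + 1 := by have : (0 : ℝ) ≤ t := ht; linarith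
  have h2 := (h.absolutelyContinuousOnInterval h1).continuousOn
  rw [uIcc_of_le h1] at h2
  refine (h2 t ⟨ht, by linarith⟩).mono_of_mem_nhdsWithin ?_
  rw [← Ici_inter_Iic]
  exact inter_mem self_mem_nhdsWithin (mem_nhdsWithin_of_mem_nhds (Iic_mem_nhds (by linarith)))

theorem continuousOn_Icc {x v : ℝ → E} (h : SolvesODE x v) {s t : ℝ} (hs : 0 ≤ s) :
    ContinuousOn x (Icc s t) :=
  h.continuousOn.mono fun _ hτ => hs.trans hτ.1

theorem congr_rate {x v w : ℝ → E} (h : SolvesODE x v) (hvw : ∀ t, 0 ≤ t → v t = w t) :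
    SolvesODE x w := by
  have key : ∀ t, 0 ≤ t → EqOn v w (uIoc 0 t) := fun t ht τ hτ => by
    rw [uIoc_of_le ht] at hτ
    exact hvw τ hτ.1.le
  refine ⟨fun t ht => (h.1 t ht).congr (key t ht), fun t ht => ?_⟩
  rw [h.2 t ht, intervalIntegral.integral_congr_ae (ae_of_all _ (key t ht))]

theorem prodMk [CompleteSpace E] [CompleteSpace F] {x v : ℝ → E} {y w : ℝ → F}
    (hx : SolvesODE x v) (hy : SolvesODE y w) :
    SolvesODE (fun t => (x t, y t)) fun t => (v t, w t) := by
  have hI : ∀ t, 0 ≤ t → IntervalIntegrable (fun τ => (v τ, w τ)) volume 0 t := fun t ht => by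
    have h1 := hx.1 t ht
    have h2 := hy.1 t ht
    rw [intervalIntegrable_iff] at h1 h2 ⊢
    exact h1.prodMk h2
  refine ⟨hI, fun t ht => ?_⟩
  have h1 := (ContinuousLinearMap.fst ℝ E F).intervalIntegral_comp_comm (hI t ht)
  have h2 := (ContinuousLinearMap.snd ℝ E F).intervalIntegral_comp_comm (hI t ht)
  ext
  · simpa [hx.2 t ht] using h1
  · simpa [hy.2 t ht] using h2

theorem of_hasDerivAt [CompleteSpace E] {x v : ℝ → E} (h : ∀ t, HasDerivAt x (v t) t)
    (hv : Continuous v) : SolvesODE x v := by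
  refine ⟨fun t _ => hv.intervalIntegrable 0 t, fun t _ => ?_⟩
  rw [intervalIntegral.integral_eq_sub_of_hasDerivAt (fun τ _ => h τ) (hv.intervalIntegrable 0 t)]
  abel

/-- Chain rule for Carathéodory solutions. -/
theorem comp [FiniteDimensional ℝ E] [CompleteSpace F] {x v : ℝ → E} (hx : SolvesODE x v)
    {f : E → F} (hf : ContDiff ℝ 1 f) :
    SolvesODE (fun t => f (x t)) fun t => fderiv ℝ f (x t) (v t) := by
  have : CompleteSpace E := FiniteDimensional.complete ℝ E
  have : ProperSpace E := FiniteDimensional.proper ℝ E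
  have hI : ∀ t, 0 ≤ t →
      IntervalIntegrable (fun τ => fderiv ℝ f (x τ) (v τ)) volume 0 t := fun t ht => by
    -- The derivative of f along x is bounded on [0, t], so the new rate is dominated by a multiple
    -- of ‖v‖.
    have hc : ContinuousOn (fun τ => fderiv ℝ f (x τ)) (Icc 0 t) :=
      (hf.continuous_fderiv one_ne_zero).comp_continuousOn (hx.continuousOn_Icc le_rfl)
    obtain ⟨C, hC⟩ := isCompact_Icc.exists_bound_of_continuousOn hc
    have hv := hx.1 t ht
    rw [intervalIntegrable_iff_integrableOn_Ioc_of_le ht] at hv ⊢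
    have hsub : Ioc 0 t ⊆ Icc 0 t := Ioc_subset_Icc_self
    refine Integrable.mono' (hv.norm.const_mul C) ?_ ?_
    · exact (ContinuousLinearMap.id ℝ (E →L[ℝ] F)).aestronglyMeasurable_comp₂
        ((hc.mono hsub).aestronglyMeasurable measurableSet_Ioc) hv.aestronglyMeasurable
    · filter_upwards [ae_restrict_mem measurableSet_Ioc] with τ hτ
      exact ((fderiv ℝ f (x τ)).le_opNorm _).trans (by gcongr; exact hC τ (hsub hτ))
  refine ⟨hI, fun t ht => ?_⟩
  have hac := hx.absolutelyContinuousOnInterval ht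
  obtain ⟨R, hR⟩ := hac.exists_bound
  -- The path stays in a compact ball, where a C¹ function is Lipschitz; hence f ∘ x is absolutely
  -- continuous.
  obtain ⟨K, hK⟩ := hf.contDiffOn.exists_lipschitzOnWith (s := Metric.closedBall (0 : E) R)
    (by decide) (convex_closedBall _ _) (isCompact_closedBall _ _)
  have hfac : AbsolutelyContinuousOnInterval (fun τ => f (x τ)) 0 t :=
    hac.of_dist_le (C := K) fun a ha b hb =>
      hK.dist_le_mul _ (by simpa using hR a ha) _ (by simpa using hR b hb)
  have hiac : AbsolutelyContinuousOnInterval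
      (fun u => ∫ τ in (0 : ℝ)..u, fderiv ℝ f (x τ) (v τ)) 0 t := by
    refine SolvesODE.absolutelyContinuousOnInterval
      (v := fun τ => fderiv ℝ f (x τ) (v τ)) ⟨hI, fun u _ => by simp⟩ ht
  -- The integral equation holds only for times ≥ 0, so a two-sided derivative of x is available
  -- only at τ > 0.
  have hne : ∀ᵐ τ : ℝ, τ ≠ 0 := by simp [ae_iff, measure_singleton]
  -- f ∘ x minus the candidate primitive is absolutely continuous with derivative zero almost
  -- everywhere, hence constant.
  obtain ⟨C, hC⟩ := (hfac.fun_sub hiac).const_of_ae_hasDerivAt_zero (by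
    filter_upwards [(hx.1 t ht).ae_hasDerivAt_integral, (hI t ht).ae_hasDerivAt_integral, hne]
      with τ h1 h2 h3 hτ
    have h1 := h1 hτ 0 left_mem_uIcc
    have h2 := h2 hτ 0 left_mem_uIcc
    rw [uIcc_of_le ht] at hτ
    have hpos : 0 < τ := lt_of_le_of_ne hτ.1 (Ne.symm h3)
    have hxd : HasDerivAt x (v τ) τ := by
      refine (h1.const_add (x 0)).congr_of_eventuallyEq ?_
      filter_upwards [Ioi_mem_nhds hpos] with u hu
      exact hx.2 u (le_of_lt hu)
    have h5 := ((hf.differentiable one_ne_zero).differentiableAt (x := x τ)).hasFDerivAt.comp_hasDerivAt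
      τ hxd
    have h6 := h5.sub h2
    rw [sub_self] at h6
    exact h6)
  have e0 := hC 0 left_mem_uIcc
  have e1 := hC t right_mem_uIcc
  simp only [intervalIntegral.integral_same, sub_zero] at e0
  change f (x t) = f (x 0) + _
  rw [e0, ← e1]
  abel

/-- Product rule. It serves three pairings below: scalar times operator, composition of operators,
operator applied to a vector. -/
theorem bilinear [FiniteDimensional ℝ E] [FiniteDimensional ℝ F] [CompleteSpace H]
    {x v : ℝ → E} {y w : ℝ → F} (hx : SolvesODE x v) (hy : SolvesODE y w)
    (B : E →L[ℝ] F →L[ℝ] H) :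
    SolvesODE (fun t => B (x t) (y t)) fun t => B (x t) (w t) + B (v t) (y t) := by
  have : CompleteSpace E := FiniteDimensional.complete ℝ E
  have : CompleteSpace F := FiniteDimensional.complete ℝ F
  have hb := B.isBoundedBilinearMap
  have h := (hx.prodMk hy).comp (f := fun q : E × F => B q.1 q.2) hb.contDiff
  refine h.congr_rate fun t _ => ?_
  rw [(hb.hasFDerivAt (x t, y t)).fderiv]
  rfl

theorem sub_const {x v : ℝ → E} (h : SolvesODE x v) (c : E) : SolvesODE (fun t => x t - c) v :=
  ⟨h.1, fun t ht => by simp only [h.2 t ht]; abel⟩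

/-- A solution starting at zero whose rate is bounded by a multiple of its norm vanishes. -/
theorem eq_zero_of_norm_rate_le {x v : ℝ → E} (h : SolvesODE x v) (h0 : x 0 = 0) {T C : ℝ}
    (hv : ∀ t ∈ Icc 0 T, ‖v t‖ ≤ C * ‖x t‖) : ∀ t ∈ Icc 0 T, x t = 0 := by
  have hcont : ContinuousOn (fun τ => ‖x τ‖) (Icc 0 T) := (h.continuousOn_Icc le_rfl).norm
  have hint : ∀ t ∈ Icc 0 T, IntervalIntegrable (fun τ => ‖x τ‖) volume 0 t := fun t ht =>
    (hcont.mono (by rw [uIcc_of_le ht.1]; exact Icc_subset_Icc_right ht.2)).intervalIntegrable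
  have hle : ∀ t ∈ Icc 0 T, ‖x t‖ ≤ C * ∫ τ in (0 : ℝ)..t, ‖x τ‖ := fun t ht => by
    rw [h.2 t ht.1, h0, zero_add, ← intervalIntegral.integral_const_mul]
    exact intervalIntegral.norm_integral_le_of_norm_le ht.1
      (ae_of_all _ fun τ hτ => hv τ ⟨hτ.1.le, hτ.2.trans ht.2⟩) ((hint t ht).const_mul C)
  have hnn : ∀ t ∈ Icc 0 T, 0 ≤ ∫ τ in (0 : ℝ)..t, ‖x τ‖ := fun t ht =>
    intervalIntegral.integral_nonneg ht.1 fun _ _ => norm_nonneg _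
  -- Grönwall is applied to the primitive of ‖x‖: unlike x itself, it has a right derivative at
  -- every point, because ‖x‖ is continuous.
  have hz := eq_zero_of_abs_deriv_le_mul_abs_self_of_eq_zero_right
    (f := fun t => ∫ τ in (0 : ℝ)..t, ‖x τ‖) (f' := fun t => ‖x t‖) (K := C) (a := 0) (b := T)
    (by
      intro t ht
      have hT : 0 ≤ T := ht.1.trans ht.2
      have := intervalIntegral.continuousOn_primitive_interval (a := 0) (b := T)
        (f := fun τ => ‖x τ‖) (μ := volume)
        (by rw [uIcc_of_le hT]; exact hcont.integrableOn_Icc)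
      rw [uIcc_of_le hT] at this
      exact this t ht)
    (by
      intro t ht
      have htm : t ∈ Icc 0 T := Ico_subset_Icc_self ht
      have hnhds : Icc 0 T ∈ 𝓝[≥] t :=
        mem_of_superset (Ico_mem_nhdsGE ht.2)
          fun τ hτ => ⟨ht.1.trans hτ.1, hτ.2.le⟩
      refine intervalIntegral.integral_hasDerivWithinAt_right (hint t htm) (s := Ici t) (t := Ioi t)
        ?_ ?_
      · refine ⟨Icc 0 T, nhdsWithin_mono _ Ioi_subset_Ici_self hnhds, ?_⟩
        exact hcont.aestronglyMeasurable measurableSet_Icc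
      · exact (hcont t htm).mono_of_mem_nhdsWithin
          (nhdsWithin_mono _ Ioi_subset_Ici_self hnhds))
    (by simp)
    (by
      intro t ht
      rw [norm_norm, Real.norm_of_nonneg (hnn t (Ico_subset_Icc_self ht))]
      exact hle t (Ico_subset_Icc_self ht))
  intro t ht
  have h1 := hle t ht
  rw [show (∫ τ in (0 : ℝ)..t, ‖x τ‖) = 0 from hz t ht, mul_zero] at h1
  exact norm_le_zero_iff.mp h1

end SolvesODE

end Caratheodory
/-! ## Projection and least squares -/

section Adaptation

variable {E : Type*} [NormedAddCommGroup E] [InnerProductSpace ℝ E]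

/-- When the projection acts, the normal component of y is multiplied by 1 - h(θ) ≤ 0; when it does
not, h(θ) > 0 forces y to point inward. -/
theorem inner_gradient_smoothProj_nonpos [CompleteSpace E] {h : E → ℝ} {θ : E} (hθ : 1 ≤ h θ)
    (y : E) : ⟪gradient h θ, smoothProj h θ y⟫_ℝ ≤ 0 := by
  unfold smoothProj
  split_ifs with hc
  · have hg : gradient h θ ≠ 0 := fun h0 => by simp [h0] at hc
    have hn : ‖gradient h θ‖ ^ 2 ≠ 0 := by simpa using hg
    rw [inner_sub_right, inner_smul_right, real_inner_self_eq_norm_sq, div_mul_cancel₀ _ hn]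
    nlinarith [hc.2]
  · by_contra hlt
    exact hc ⟨by linarith, not_le.mp hlt⟩

/-- The smooth projection keeps the sublevel set `{h ≤ 1}` invariant. -/
theorem SolvesODE.smoothProj_invariant [FiniteDimensional ℝ E] [CompleteSpace E] {h : E → ℝ} (hh : ContDiff ℝ 1 h)
    {x y : ℝ → E} (hx : SolvesODE x fun t => smoothProj h (x t) (y t)) (h0 : h (x 0) ≤ 1) :
    ∀ t, 0 ≤ t → h (x t) ≤ 1 := by
  intro t ht
  by_contra hlt
  rw [not_le] at hlt
  have hH := hx.comp hh
  have hcomp : IsCompact (Icc 0 t ∩ (fun τ => h (x τ)) ⁻¹' Iic 1) :=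
    isCompact_Icc.of_isClosed_subset ((hH.continuousOn_Icc le_rfl).preimage_isClosed_of_isClosed
      isClosed_Icc isClosed_Iic) inter_subset_left
  -- s is the last time in [0, t] with h ≤ 1. After it the rate of h is nonpositive, so h(x t) ≤ h(x
  -- s) ≤ 1.
  obtain ⟨s, ⟨hs, hs1⟩, hmax⟩ := hcomp.exists_isGreatest ⟨0, ⟨le_rfl, ht⟩, h0⟩
  have hs1 : h (x s) ≤ 1 := hs1
  have hint := hH.sub_eq_integral hs.1 ht
  rw [intervalIntegral.integral_of_le hs.2] at hint
  have : ∫ τ in Ioc s t, fderiv ℝ h (x τ) (smoothProj h (x τ) (y τ)) ≤ 0 := by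
    refine setIntegral_nonpos measurableSet_Ioc fun τ hτ => ?_
    have hgt : 1 ≤ h (x τ) := by
      by_contra hle
      exact absurd (hmax ⟨⟨hs.1.trans hτ.1.le, hτ.2⟩, (not_le.mp hle).le⟩) (not_le.mpr hτ.1)
    have := inner_gradient_smoothProj_nonpos hgt (y τ)
    rwa [gradient, InnerProductSpace.toDual_symm_apply] at this
  linarith

/-- Bound on the estimate of a continuous-time least-squares law with forgetting factor `β` under
uniform excitation: in the coordinates `M w`, where `M` is the `exp (β t)`-weighted information
matrix, the law is driven by the residual `c` alone. -/
theorem leastSquares_norm_le [FiniteDimensional ℝ E] {Γ A : ℝ → E →L[ℝ] E} {w c : ℝ → E} {P : E →L[ℝ] E}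
    {β p₀ p₁ a₀ a₁ c₀ : ℝ} (hβ : 0 < β) (hp₀ : 0 < p₀) (ha₀ : 0 < a₀)
    (hΓ : SolvesODE Γ fun t => β • Γ t - Γ t ∘L A t ∘L Γ t)
    (hw : SolvesODE w fun t => -(Γ t (A t (w t) + c t)))
    (hA : AEStronglyMeasurable A (volume.restrict (Ici 0)))
    (hA₁ : ∀ t, 0 ≤ t → ‖A t‖ ≤ a₁) (hA₀ : ∀ t, 0 ≤ t → ∀ x, a₀ * ‖x‖ ^ 2 ≤ ⟪A t x, x⟫_ℝ)
    (hP : P ∘L Γ 0 = 1) (hP₁ : ‖P‖ ≤ p₁) (hP₀ : ∀ x, p₀ * ‖x‖ ^ 2 ≤ ⟪P x, x⟫_ℝ)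
    (hc : ∀ t, 0 ≤ t → ‖c t‖ ≤ c₀) {s t : ℝ} (hs : 0 ≤ s) (hst : s ≤ t) :
    ‖w t‖ ≤ ((p₁ + a₁ / β) * Real.exp (-β * (t - s)) * ‖w s‖ + c₀ / β) / min p₀ (a₀ / β) := by
  have : CompleteSpace E := FiniteDimensional.complete ℝ E
  have ht : 0 ≤ t := hs.trans hst
  have ha₁ : 0 ≤ a₁ := (norm_nonneg _).trans (hA₁ 0 le_rfl)
  have hc₀ : 0 ≤ c₀ := (norm_nonneg _).trans (hc 0 le_rfl)
  have hp₁ : 0 ≤ p₁ := (norm_nonneg _).trans hP₁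
  have hexpc : Continuous fun τ : ℝ => Real.exp (β * τ) := by fun_prop
  have hexpi : ∀ a b : ℝ, ∫ τ in a..b, Real.exp (β * τ)
      = (Real.exp (β * b) - Real.exp (β * a)) / β := fun a b => by
    rw [intervalIntegral.integral_comp_mul_left (fun τ => Real.exp τ) hβ.ne', integral_exp,
      smul_eq_mul, inv_mul_eq_div]
  set B : ℝ → E →L[ℝ] E := fun τ => Real.exp (β * τ) • A τ with hB
  have hBn : ∀ τ, 0 ≤ τ → ‖B τ‖ ≤ Real.exp (β * τ) * a₁ := fun τ hτ => by
    rw [hB, norm_smul, Real.norm_of_nonneg (Real.exp_pos _).le]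
    gcongr
    exact hA₁ τ hτ
  have hBi : ∀ u, 0 ≤ u → IntervalIntegrable B volume 0 u := fun u hu => by
    rw [intervalIntegrable_iff_integrableOn_Ioc_of_le hu]
    refine Integrable.mono' (g := fun τ => Real.exp (β * τ) * a₁) ?_ ?_ ?_
    · exact (hexpc.mul continuous_const).integrableOn_Ioc
    · exact (hexpc.aestronglyMeasurable.smul
        (hA.mono_set fun τ hτ => hτ.1.le))
    · filter_upwards [ae_restrict_mem measurableSet_Ioc] with τ hτ
      exact hBn τ hτ.1.le
  -- M(u) stands for e^{βu}Γ(u)⁻¹, but is defined by its integral, so that invertibility of Γ(u)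
  -- need not be known beforehand.
  set M : ℝ → E →L[ℝ] E := fun u => P + ∫ τ in (0 : ℝ)..u, B τ with hM
  have hMs : SolvesODE M B := ⟨hBi, fun u _ => by simp [hM]⟩
  have hX := (SolvesODE.of_hasDerivAt (x := fun τ => Real.exp (-β * τ))
    (v := fun τ => Real.exp (-β * τ) * -β)
    (fun τ => by simpa using ((hasDerivAt_id τ).const_mul (-β)).exp) (by fun_prop)).bilinear hΓ
    (ContinuousLinearMap.lsmul ℝ ℝ)
  simp only [ContinuousLinearMap.lsmul_apply] at hX
  -- The factor e^{-βτ} removes the forgetting term, leaving the Riccati equation X' = -X B X.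
  set X : ℝ → E →L[ℝ] E := fun τ => Real.exp (-β * τ) • Γ τ with hXdef
  have hXs : SolvesODE X fun τ => -(X τ ∘L B τ ∘L X τ) := by
    refine hX.congr_rate fun τ _ => ?_
    have he : Real.exp (-β * τ) * Real.exp (β * τ) = 1 := by
      rw [← Real.exp_add]; simp
    ext v
    simp only [hXdef, hB, _root_.add_apply, _root_.smul_apply,
      _root_.sub_apply, ContinuousLinearMap.comp_apply, _root_.neg_apply,
      map_smul, smul_sub, smul_smul]
    rw [he]
    module
  -- Z = M X - 1 satisfies the linear equation Z' = -Z B X with Z(0) = 0, hence vanishes.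
  have hMX : ∀ u, 0 ≤ u → M u ∘L X u = 1 := by
    have hZ := (hMs.bilinear hXs (ContinuousLinearMap.compL ℝ E E E)).sub_const 1
    simp only [ContinuousLinearMap.compL_apply] at hZ
    intro u hu
    obtain ⟨C, hC⟩ := isCompact_Icc.exists_bound_of_continuousOn
      (hXs.continuousOn_Icc (s := 0) (t := u) le_rfl)
    have h0 : M 0 ∘L X 0 - 1 = 0 := by simp [hM, hXdef, hP]
    have hCn : 0 ≤ C := (norm_nonneg _).trans (hC 0 ⟨le_rfl, hu⟩)
    refine sub_eq_zero.mp (hZ.eq_zero_of_norm_rate_le h0 (T := u)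
      (C := Real.exp (β * u) * a₁ * C) (fun τ hτ => ?_) u ⟨hu, le_rfl⟩)
    have hrate : M τ ∘L (-(X τ ∘L B τ ∘L X τ)) + B τ ∘L X τ
        = -((M τ ∘L X τ - 1) ∘L (B τ ∘L X τ)) := by
      ext v
      simp [neg_add_eq_sub]
    rw [hrate, norm_neg, mul_comm]
    refine (ContinuousLinearMap.opNorm_comp_le _ _).trans ?_
    gcongr
    refine (ContinuousLinearMap.opNorm_comp_le _ _).trans ?_
    gcongr
    · refine (hBn τ hτ.1).trans ?_
      gcongr
      exact hτ.2
    · exact hC τ hτ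
  have hMΓ : ∀ u, 0 ≤ u → ∀ v, M u (Γ u v) = Real.exp (β * u) • v := fun u hu v => by
    have h1 := congrArg (fun L : E →L[ℝ] E => Real.exp (β * u) • L v) (hMX u hu)
    simpa [hXdef, smul_smul, ← Real.exp_add] using h1
  -- The term B w from M' cancels M Γ A w, since M Γ = e^{βu}.
  have hy : SolvesODE (fun u => M u (w u)) fun u => -(Real.exp (β * u) • c u) := by
    refine (hMs.bilinear hw (ContinuousLinearMap.id ℝ (E →L[ℝ] E))).congr_rate fun u hu => ?_
    simp only [ContinuousLinearMap.id_apply, map_neg, hMΓ u hu, hB,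
      _root_.smul_apply, smul_add]
    abel
  have hdiff : ‖M t (w t) - M s (w s)‖ ≤ Real.exp (β * t) * (c₀ / β) := by
    rw [hy.sub_eq_integral hs ht]
    refine (intervalIntegral.norm_integral_le_of_norm_le (g := fun τ => Real.exp (β * τ) * c₀) hst
      (ae_of_all _ fun τ hτ => ?_) ((hexpc.mul continuous_const).intervalIntegrable _ _)).trans ?_
    · rw [norm_neg, norm_smul, Real.norm_of_nonneg (Real.exp_pos _).le]
      gcongr
      exact hc τ (hs.trans hτ.1.le)
    · rw [intervalIntegral.integral_mul_const, hexpi, div_mul_eq_mul_div, ← mul_div_assoc]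
      gcongr
      linarith [Real.exp_pos (β * s)]
  have hMn : ‖M s‖ ≤ (p₁ + a₁ / β) * Real.exp (β * s) := by
    have h1 : ‖∫ τ in (0 : ℝ)..s, B τ‖ ≤ Real.exp (β * s) * (a₁ / β) := by
      refine (intervalIntegral.norm_integral_le_of_norm_le (g := fun τ => Real.exp (β * τ) * a₁) hs
        (ae_of_all _ fun τ hτ => hBn τ hτ.1.le)
        ((hexpc.mul continuous_const).intervalIntegrable _ _)).trans ?_
      rw [intervalIntegral.integral_mul_const, hexpi, div_mul_eq_mul_div, ← mul_div_assoc]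
      gcongr
      linarith [Real.exp_pos (β * 0)]
    have h2 : p₁ ≤ p₁ * Real.exp (β * s) :=
      le_mul_of_one_le_right hp₁ (Real.one_le_exp (by positivity))
    calc ‖M s‖ ≤ ‖P‖ + ‖∫ τ in (0 : ℝ)..s, B τ‖ := norm_add_le _ _
      _ ≤ (p₁ + a₁ / β) * Real.exp (β * s) := by linarith
  set m := min p₀ (a₀ / β) with hm
  have hm0 : 0 < m := lt_min hp₀ (by positivity)
  -- ⟨M(t)x, x⟩ ≥ (p₀ + (a₀/β)(e^{βt} - 1))‖x‖², and both p₀ and a₀/β are at least m, so the bracket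
  -- is at least m e^{βt}.
  have hcoer : ∀ x, m * Real.exp (β * t) * ‖x‖ ≤ ‖M t x‖ := fun x => by
    have hev : ⟪M t x, x⟫_ℝ = ⟪P x, x⟫_ℝ + ∫ τ in (0 : ℝ)..t, ⟪B τ x, x⟫_ℝ := by
      have h1 := ((innerSL ℝ x).comp (ContinuousLinearMap.apply ℝ E x)).intervalIntegral_comp_comm
        (hBi t ht)
      simp only [ContinuousLinearMap.comp_apply, ContinuousLinearMap.apply_apply,
        innerSL_apply_apply] at h1
      simp only [hM, _root_.add_apply, inner_add_left]
      rw [real_inner_comm x, real_inner_comm x, ← h1]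
      simp only [real_inner_comm x]
    have hint : ∫ τ in (0 : ℝ)..t, Real.exp (β * τ) * (a₀ * ‖x‖ ^ 2)
        ≤ ∫ τ in (0 : ℝ)..t, ⟪B τ x, x⟫_ℝ := by
      refine intervalIntegral.integral_mono_on ht
        ((hexpc.mul continuous_const).intervalIntegrable _ _) ?_ fun τ hτ => ?_
      · have := ((innerSL ℝ x).comp (ContinuousLinearMap.apply ℝ E x)).integrable_comp
          ((intervalIntegrable_iff_integrableOn_Ioc_of_le ht).mp (hBi t ht))
        rw [intervalIntegrable_iff_integrableOn_Ioc_of_le ht]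
        refine this.congr (ae_of_all _ fun τ => ?_)
        simp [real_inner_comm x]
      · rw [hB, _root_.smul_apply, inner_smul_left]
        exact mul_le_mul_of_nonneg_left (hA₀ τ hτ.1 x) (Real.exp_pos _).le
    rw [intervalIntegral.integral_mul_const, hexpi, mul_zero, Real.exp_zero] at hint
    have he1 : 0 ≤ Real.exp (β * t) - 1 := by
      linarith [Real.one_le_exp (show 0 ≤ β * t by positivity)]
    have h2 : m * ‖x‖ ^ 2 ≤ ⟪P x, x⟫_ℝ :=
      (mul_le_mul_of_nonneg_right (min_le_left _ _) (by positivity)).trans (hP₀ x)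
    have h3 : m * ((Real.exp (β * t) - 1) * ‖x‖ ^ 2)
        ≤ (Real.exp (β * t) - 1) / β * (a₀ * ‖x‖ ^ 2) := by
      calc m * ((Real.exp (β * t) - 1) * ‖x‖ ^ 2)
          ≤ a₀ / β * ((Real.exp (β * t) - 1) * ‖x‖ ^ 2) := by
            gcongr
            exact min_le_right _ _
        _ = _ := by ring
    have h4 : m * Real.exp (β * t) * ‖x‖ * ‖x‖ ≤ ‖M t x‖ * ‖x‖ := by
      refine le_trans ?_ (real_inner_le_norm (M t x) x)
      rw [hev]
      nlinarith
    rcases (norm_nonneg x).eq_or_lt with h0 | h0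
    · rw [← h0, mul_zero]; exact norm_nonneg _
    · exact le_of_mul_le_mul_right h4 h0
  have hfin : m * Real.exp (β * t) * ‖w t‖
      ≤ (p₁ + a₁ / β) * Real.exp (β * s) * ‖w s‖ + Real.exp (β * t) * (c₀ / β) := by
    refine (hcoer (w t)).trans ?_
    have h1 : ‖M t (w t)‖ ≤ ‖M s (w s)‖ + ‖M t (w t) - M s (w s)‖ :=
      norm_le_norm_add_norm_sub' _ _
    have h2 : ‖M s (w s)‖ ≤ (p₁ + a₁ / β) * Real.exp (β * s) * ‖w s‖ :=
      ((M s).le_opNorm _).trans (by gcongr)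
    linarith
  rw [le_div_iff₀ hm0]
  have hes : Real.exp (β * s) = Real.exp (-β * (t - s)) * Real.exp (β * t) := by
    rw [← Real.exp_add]; ring_nf
  rw [hes] at hfin
  refine le_of_mul_le_mul_right ?_ (Real.exp_pos (β * t))
  linarith

end Adaptation
/-! ## Coercivity of symmetric operators -/

section Coercive

variable {E : Type*} [NormedAddCommGroup E] [InnerProductSpace ℝ E] [FiniteDimensional ℝ E]

/-- Expansion in an orthonormal eigenbasis; this turns the sampling rank condition into coercivity.
-/
theorem ContinuousLinearMap.mul_norm_sq_le_inner_of_hasEigenvalue {T : E →L[ℝ] E}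
    (hT : (T : E →ₗ[ℝ] E).IsSymmetric) {a : ℝ}
    (h : ∀ μ : ℝ, Module.End.HasEigenvalue (T : E →ₗ[ℝ] E) μ → a ≤ μ) (x : E) :
    a * ‖x‖ ^ 2 ≤ ⟪T x, x⟫_ℝ := by
  let b := hT.eigenvectorBasis rfl
  have hb : ∀ i, ⟪T x, b i⟫_ℝ = hT.eigenvalues rfl i * ⟪x, b i⟫_ℝ := fun i => by
    have h1 : ⟪T x, b i⟫_ℝ = ⟪x, T (b i)⟫_ℝ := hT x (b i)
    have h2 : T (b i) = (hT.eigenvalues rfl i : ℝ) • b i := hT.apply_eigenvectorBasis rfl i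
    rw [h1, h2, inner_smul_right]
  rw [← b.sum_inner_mul_inner (T x) x, ← real_inner_self_eq_norm_sq, ← b.sum_inner_mul_inner x x,
    Finset.mul_sum]
  refine Finset.sum_le_sum fun i _ => ?_
  rw [hb i, mul_assoc, real_inner_comm x (b i)]
  exact mul_le_mul_of_nonneg_right (h _ (hT.hasEigenvalue_eigenvalues rfl i)) (mul_self_nonneg _)

theorem ContinuousLinearMap.exists_mul_norm_sq_le_inner {T : E →L[ℝ] E}
    (h : ∀ x, x ≠ 0 → 0 < ⟪T x, x⟫_ℝ) : ∃ a, 0 < a ∧ ∀ x, a * ‖x‖ ^ 2 ≤ ⟪T x, x⟫_ℝ := by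
  have : ProperSpace E := FiniteDimensional.proper ℝ E
  -- The constant is the minimum over the unit sphere, which is empty in the zero space.
  rcases subsingleton_or_nontrivial E with hE | hE
  · exact ⟨1, one_pos, fun x => by simp [Subsingleton.elim x 0]⟩
  obtain ⟨u, hu, hmin⟩ := (isCompact_sphere (0 : E) 1).exists_isMinOn
    (NormedSpace.sphere_nonempty.mpr zero_le_one)
    (f := fun x => ⟪T x, x⟫_ℝ) (by fun_prop)
  have hu0 : u ≠ 0 := fun h0 => by simp [h0] at hu
  refine ⟨⟪T u, u⟫_ℝ, h u hu0, fun x => ?_⟩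
  rcases eq_or_ne x 0 with rfl | hx
  · simp
  have hn : ‖x‖ ≠ 0 := norm_ne_zero_iff.mpr hx
  have h1 := hmin (show ‖x‖⁻¹ • x ∈ Metric.sphere (0 : E) 1 by simp [norm_smul, hn])
  simp only [map_smul, inner_smul_left, inner_smul_right, mem_ofPred_eq] at h1
  simp only [conj_trivial, ← mul_assoc] at h1
  calc ⟪T u, u⟫_ℝ * ‖x‖ ^ 2 ≤ (‖x‖⁻¹ * ‖x‖⁻¹ * ⟪T x, x⟫_ℝ) * ‖x‖ ^ 2 := by gcongr
    _ = ⟪T x, x⟫_ℝ := by field_simp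

end Coercive

/-- Supplies the initial value Γ₀⁻¹ of the information matrix in `leastSquares_norm_le`. -/
theorem Matrix.PosDef.exists_coercive_leftInverse {l : ℕ} {A : Matrix (Fin l) (Fin l) ℝ}
    (hA : A.PosDef) : ∃ P : Vec l →L[ℝ] Vec l, P ∘L A.op = 1 ∧
      ∃ a, 0 < a ∧ ∀ x, a * ‖x‖ ^ 2 ≤ ⟪P x, x⟫_ℝ := by
  refine ⟨A⁻¹.op, ?_, ContinuousLinearMap.exists_mul_norm_sq_le_inner fun x hx => ?_⟩
  · have h1 : A⁻¹ * A = 1 := Matrix.nonsing_inv_mul A hA.det_pos.ne'.isUnit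
    have h2 := congrArg (Matrix.toEuclideanCLM (n := Fin l) (𝕜 := ℝ)) h1
    rwa [map_mul, map_one] at h2
  · have hx' : x.ofLp ≠ 0 := fun h0 => hx (by ext i; simp [h0])
    have h1 := hA.inv.dotProduct_mulVec_pos hx'
    rw [real_inner_comm, EuclideanSpace.inner_eq_star_dotProduct]
    simpa [dotProduct_comm] using h1

/-! ## Regressors -/

/-- (1 + r²)² dominates both r and r². Hence `normalized` and `Lam` are bounded by 1 whatever the
size of the regressor. -/
theorem Design.normalized_scale_le {l : ℕ} (φ : Vec l) :
    1 / (1 + ⟪φ, φ⟫_ℝ) ^ 2 * ‖φ‖ ≤ 1 ∧ 1 / (1 + ⟪φ, φ⟫_ℝ) ^ 2 * ‖φ‖ ^ 2 ≤ 1 := by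
  have h0 := norm_nonneg φ
  rw [real_inner_self_eq_norm_sq, one_div_mul_eq_div, one_div_mul_eq_div,
    div_le_one (by positivity), div_le_one (by positivity)]
  constructor <;> nlinarith [sq_nonneg (‖φ‖ - 1), sq_nonneg (‖φ‖ ^ 2)]

theorem Design.norm_normalized_le {l : ℕ} (φ : Vec l) : ‖Design.normalized φ‖ ≤ 1 := by
  rw [Design.normalized, norm_smul, Real.norm_of_nonneg (by positivity)]
  exact (Design.normalized_scale_le φ).1

theorem Design.norm_Lam_le {l : ℕ} (φ : Vec l) : ‖Design.Lam φ‖ ≤ 1 := by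
  rw [Design.Lam, norm_smul, Real.norm_of_nonneg (by positivity), InnerProductSpace.norm_rankOne,
    ← pow_two]
  exact (Design.normalized_scale_le φ).2

theorem Design.Lam_apply {l : ℕ} (φ w : Vec l) :
    Design.Lam φ w = ⟪w, φ⟫_ℝ • Design.normalized φ := by
  rw [Design.Lam, Design.normalized, _root_.smul_apply, InnerProductSpace.rankOne_apply,
    smul_comm, real_inner_comm]

theorem Design.inner_Lam_nonneg {l : ℕ} (φ w : Vec l) : 0 ≤ ⟪Design.Lam φ w, w⟫_ℝ := by
  rw [Design.Lam_apply, Design.normalized, inner_smul_left, inner_smul_left, conj_trivial,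
    conj_trivial, real_inner_comm, ← mul_assoc, mul_comm ⟪φ, w⟫_ℝ, mul_assoc]
  exact mul_nonneg (by positivity) (mul_self_nonneg _)

theorem Design.Lam_isSymmetric {l : ℕ} (φ : Vec l) :
    (Design.Lam φ : Vec l →ₗ[ℝ] Vec l).IsSymmetric := fun x y => by
  simp only [ContinuousLinearMap.coe_coe, Design.Lam_apply, Design.normalized, inner_smul_left,
    inner_smul_right, conj_trivial]
  rw [real_inner_comm φ y, real_inner_comm φ x]
  ring

theorem Design.continuous_Lam {l : ℕ} : Continuous fun φ : Vec l => Design.Lam φ := by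
  have h1 : Continuous fun φ : Vec l => 1 / (1 + ⟪φ, φ⟫_ℝ) ^ 2 := by
    refine Continuous.div continuous_const (by fun_prop) fun φ => ?_
    have : 0 ≤ ⟪φ, φ⟫_ℝ := real_inner_self_nonneg
    positivity
  have h2 : Continuous fun φ : Vec l => InnerProductSpace.rankOne ℝ φ φ :=
    ((InnerProductSpace.rankOne ℝ (E := Vec l) (F := Vec l)).continuous).clm_apply continuous_id
  exact h1.smul h2

/-! ### Continuity of the learned policies and uniform bound on their reward -/

namespace Design

variable {n p m l N : ℕ} {G : PEGame n p} (D : Design G m l)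

theorem continuous_unHat {X : Type*} [TopologicalSpace X] {z ξ : X → State n} {w : X → Vec l}
    (hz : Continuous z) (hξ : Continuous ξ) (hw : Continuous w) :
    Continuous fun q => D.unHat (z q) (ξ q) (w q) := by
  unfold unHat
  have h1 := G.gp_lip.continuous
  have h2 := D.ϑ_smooth.continuous_fderiv one_ne_zero
  have h3 : Continuous fun q => ContinuousLinearMap.adjoint (G.gp (z q)) :=
    ContinuousLinearMap.adjoint.continuous.comp (h1.comp hz)
  have h4 : Continuous fun q => ContinuousLinearMap.adjoint (fderiv ℝ D.ϑ (ξ q)) :=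
    ContinuousLinearMap.adjoint.continuous.comp (h2.comp hξ)
  exact ((G.R⁻¹.op).continuous.comp (h3.clm_apply (h4.clm_apply hw))).const_smul (_ : ℝ)

theorem continuous_ueHat {X : Type*} [TopologicalSpace X] {z ξ : X → State n} {w : X → Vec l}
    (hz : Continuous z) (hξ : Continuous ξ) (hw : Continuous w) :
    Continuous fun q => D.ueHat (z q) (ξ q) (w q) := by
  unfold ueHat
  have h1 := G.ge_lip.continuous
  have h2 := D.ϑ_smooth.continuous_fderiv one_ne_zero
  have h3 : Continuous fun q => ContinuousLinearMap.adjoint (G.ge (z q)) :=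
    ContinuousLinearMap.adjoint.continuous.comp (h1.comp hz)
  have h4 : Continuous fun q => ContinuousLinearMap.adjoint (fderiv ℝ D.ϑ (ξ q)) :=
    ContinuousLinearMap.adjoint.continuous.comp (h2.comp hξ)
  exact ((G.T⁻¹.op).continuous.comp (h3.clm_apply (h4.clm_apply hw))).const_smul (_ : ℝ)

theorem continuous_regressor : Continuous fun q : State n × State n × Vec l × Vec l =>
    D.regressor q.1 q.2.1 q.2.2.1 q.2.2.2 := by
  unfold regressor PEGame.drift
  have hξ : Continuous fun q : State n × State n × Vec l × Vec l => q.1 - q.2.1 := by fun_prop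
  have hfp := G.fp_lip.continuous
  have hfe := G.fe_lip.continuous
  have hgp := G.gp_lip.continuous
  have hge := G.ge_lip.continuous
  have hun := D.continuous_unHat (z := fun q : State n × State n × Vec l × Vec l => q.1)
    (by fun_prop) hξ (w := fun q => q.2.2.1) (by fun_prop)
  have hue := D.continuous_ueHat (z := fun q : State n × State n × Vec l × Vec l => q.2.1)
    (by fun_prop) hξ (w := fun q => q.2.2.2) (by fun_prop)
  exact ((D.ϑ_smooth.continuous_fderiv one_ne_zero).comp hξ).clm_apply
    ((((hfp.comp continuous_fst).sub (hfe.comp (by fun_prop))).add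
      ((hgp.comp continuous_fst).clm_apply hun)).sub ((hge.comp (by fun_prop)).clm_apply hue))

/-- Reward of the estimated policies. -/
noncomputable def policyReward (zp ze : State n) (wa wp : Vec l) : ℝ :=
  G.reward (zp - ze) (D.unHat zp (zp - ze) wa) (D.ueHat ze (zp - ze) wp)

theorem continuous_policyReward : Continuous fun q : State n × State n × Vec l × Vec l =>
    D.policyReward q.1 q.2.1 q.2.2.1 q.2.2.2 := by
  unfold policyReward PEGame.reward
  have hξ : Continuous fun q : State n × State n × Vec l × Vec l => q.1 - q.2.1 := by fun_prop
  have hQ := G.Q_cont.comp hξ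
  have hun := D.continuous_unHat (z := fun q : State n × State n × Vec l × Vec l => q.1)
    (by fun_prop) hξ (w := fun q => q.2.2.1) (by fun_prop)
  have hue := D.continuous_ueHat (z := fun q : State n × State n × Vec l × Vec l => q.2.1)
    (by fun_prop) hξ (w := fun q => q.2.2.2) (by fun_prop)
  exact (hQ.add (hun.inner (G.R.op.continuous.comp hun))).sub
    (continuous_const.mul (hue.inner (G.T.op.continuous.comp hue)))

/-- The constant depends only on Ωp, Ωe and {h ≤ 1}, hence serves all trajectories and all samples
at once. -/
theorem exists_policyReward_bound {Ωp Ωe : Set (State n)} (hΩp : IsCompact Ωp)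
    (hΩe : IsCompact Ωe) : ∃ C, 0 ≤ C ∧ ∀ zp ∈ Ωp, ∀ ze ∈ Ωe, ∀ wa wp, D.h wa ≤ 1 → D.h wp ≤ 1 →
      |D.policyReward zp ze wa wp| ≤ C := by
  obtain ⟨C, hC⟩ := (hΩp.prod (hΩe.prod (D.h_compact.prod D.h_compact))).exists_bound_of_continuousOn
    D.continuous_policyReward.continuousOn
  exact ⟨max C 0, le_max_right _ _, fun zp hzp ze hze wa wp ha hb =>
    (hC (zp, ze, wa, wp) ⟨hzp, hze, ha, hb⟩).trans (le_max_left _ _)⟩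

/-! ### The critic law as an affine equation in the critic weights -/

variable (σ : Signals n p m l N)

/-- Excitation `k_{c1} Λ + (k_{c2}/N) ∑ Λ_i` of the critic. -/
noncomputable def excitation (t : ℝ) : Vec l →L[ℝ] Vec l := D.kc₁ • Lam (D.φ σ t) + D.kc₂ • D.avgLam σ t

/-- The part of the critic law that does not depend on the critic weights. -/
noncomputable def criticForcing (t : ℝ) : Vec l :=
  (D.kc₁ * D.policyReward (σ.zp t) (σ.ze t) (σ.Wa t) (σ.Wp t)) • normalized (D.φ σ t) +
    (D.kc₂ / N) • ∑ i, D.policyReward (σ.zps i t) (σ.zes i t) (σ.Wa t) (σ.Wp t) •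
      normalized (D.φs σ i t)

/-- In δ only the term ⟨Ŵ_c, φ⟩ involves the critic, and ⟨w, φ⟩ φ/ρ² = Λ w. -/
theorem criticRate_eq (t : ℝ) :
    D.criticRate σ t = -(σ.Γ t (D.excitation σ t (σ.Wc t) + D.criticForcing σ t)) := by
  rw [criticRate]
  congr 2
  have h1 : D.δ σ t = ⟪σ.Wc t, D.φ σ t⟫_ℝ
      + D.policyReward (σ.zp t) (σ.ze t) (σ.Wa t) (σ.Wp t) := rfl
  have h2 : ∀ i, D.δs σ i t = ⟪σ.Wc t, D.φs σ i t⟫_ℝ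
      + D.policyReward (σ.zps i t) (σ.zes i t) (σ.Wa t) (σ.Wp t) := fun i => rfl
  simp only [excitation, criticForcing, avgLam, h1, h2, _root_.add_apply, _root_.smul_apply,
    _root_.sum_apply, Lam_apply, add_smul, Finset.sum_add_distrib, smul_add, mul_add, smul_smul,
    mul_one_div]
  abel

theorem norm_avgLam_le (t : ℝ) : ‖D.avgLam σ t‖ ≤ 1 := by
  rw [avgLam, norm_smul, Real.norm_of_nonneg (by positivity)]
  have h1 : ‖∑ i, Lam (D.φs σ i t)‖ ≤ N := by
    simpa using norm_sum_le_of_le Finset.univ fun i _ => norm_Lam_le (D.φs σ i t)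
  calc 1 / (N : ℝ) * ‖∑ i, Lam (D.φs σ i t)‖ ≤ 1 / (N : ℝ) * N := by gcongr
    -- `N = 0` is allowed: then N / N = 0.
    _ ≤ 1 := by rw [one_div_mul_eq_div]; exact div_self_le_one _

theorem norm_excitation_le (t : ℝ) : ‖D.excitation σ t‖ ≤ D.kc₁ + D.kc₂ := by
  refine (norm_add_le _ _).trans ?_
  rw [norm_smul, norm_smul, Real.norm_of_nonneg D.kc₁_pos.le, Real.norm_of_nonneg D.kc₂_pos.le]
  exact add_le_add (mul_le_of_le_one_right D.kc₁_pos.le (norm_Lam_le _))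
    (mul_le_of_le_one_right D.kc₂_pos.le (D.norm_avgLam_le σ t))

theorem avgLam_isSymmetric (t : ℝ) : (D.avgLam σ t : Vec l →ₗ[ℝ] Vec l).IsSymmetric := by
  intro x y
  have h : ∀ i, ⟪Lam (D.φs σ i t) x, y⟫_ℝ = ⟪x, Lam (D.φs σ i t) y⟫_ℝ :=
    fun i => Lam_isSymmetric (D.φs σ i t) x y
  simp only [ContinuousLinearMap.coe_coe, avgLam, _root_.smul_apply, _root_.sum_apply,
    inner_smul_left, inner_smul_right, sum_inner, inner_sum, h, conj_trivial]

/-- The samples alone give the lower bound; the term along the trajectory is positive semidefinite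
and is dropped. -/
theorem le_inner_excitation {lamc : ℝ} (h : D.SamplingRank σ lamc) {t : ℝ} (ht : 0 ≤ t)
    (x : Vec l) : D.kc₂ * lamc * ‖x‖ ^ 2 ≤ ⟪D.excitation σ t x, x⟫_ℝ := by
  have h1 := ContinuousLinearMap.mul_norm_sq_le_inner_of_hasEigenvalue
    (D.avgLam_isSymmetric σ t) (h t ht) x
  have h2 := mul_nonneg D.kc₁_pos.le (inner_Lam_nonneg (D.φ σ t) x)
  have h3 := mul_le_mul_of_nonneg_left h1 D.kc₂_pos.le
  simp only [excitation, _root_.add_apply, _root_.smul_apply, inner_add_left, inner_smul_left,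
    conj_trivial]
  linarith

theorem norm_criticForcing_le {C t : ℝ} (hC : 0 ≤ C)
    (h : |D.policyReward (σ.zp t) (σ.ze t) (σ.Wa t) (σ.Wp t)| ≤ C)
    (hs : ∀ i, |D.policyReward (σ.zps i t) (σ.zes i t) (σ.Wa t) (σ.Wp t)| ≤ C) :
    ‖D.criticForcing σ t‖ ≤ (D.kc₁ + D.kc₂) * C := by
  have hk₁ := D.kc₁_pos
  have hk₂ := D.kc₂_pos
  refine (norm_add_le _ _).trans ?_
  rw [norm_smul, norm_smul, norm_mul, Real.norm_of_nonneg D.kc₁_pos.le,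
    Real.norm_of_nonneg (show 0 ≤ D.kc₂ / (N : ℝ) by positivity), add_mul]
  refine add_le_add ?_ ?_
  · refine (mul_le_of_le_one_right (by positivity) (norm_normalized_le _)).trans ?_
    gcongr
    exact h
  · have h1 : ‖∑ i, D.policyReward (σ.zps i t) (σ.zes i t) (σ.Wa t) (σ.Wp t) •
        normalized (D.φs σ i t)‖ ≤ N * C := by
      have := norm_sum_le_of_le Finset.univ (f := fun i =>
        D.policyReward (σ.zps i t) (σ.zes i t) (σ.Wa t) (σ.Wp t) • normalized (D.φs σ i t))
        (n := fun _ => C) fun i _ => by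
          rw [norm_smul]
          exact (mul_le_of_le_one_right (norm_nonneg _) (norm_normalized_le _)).trans (hs i)
      simpa using this
    calc D.kc₂ / N * ‖_‖ ≤ D.kc₂ / N * (N * C) := by gcongr
      _ = D.kc₂ * C * ((N : ℝ) / N) := by ring
      _ ≤ D.kc₂ * C := mul_le_of_le_one_right (by positivity) (div_self_le_one _)

variable {D σ}

/-- The samples are only measurable in time, so the excitation need not be continuous; measurability
and boundedness make the information matrix a well-defined integral. -/
theorem ClosedLoop.aestronglyMeasurable_excitation (hσ : D.ClosedLoop σ)
    {Ωp Ωe : Set (State n)} (hs : σ.SamplesIn Ωp Ωe) :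
    AEStronglyMeasurable (D.excitation σ) (volume.restrict (Ici 0)) := by
  have meas : ∀ {F : Type} [NormedAddCommGroup F] [NormedSpace ℝ F] {x v : ℝ → F}
      [SecondCountableTopology F], SolvesODE x v →
      AEStronglyMeasurable x (volume.restrict (Ici 0)) := fun h =>
    h.continuousOn.aestronglyMeasurable measurableSet_Ici
  have hw := (meas hσ.actor).prodMk (meas hσ.perturber)
  have h0 := continuous_Lam.comp_aestronglyMeasurable
    (D.continuous_regressor.comp_aestronglyMeasurable
      ((meas hσ.pursuer).prodMk ((meas hσ.evader).prodMk hw)))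
  have hi : ∀ i, AEStronglyMeasurable (fun t => Lam (D.φs σ i t)) (volume.restrict (Ici 0)) :=
    fun i => continuous_Lam.comp_aestronglyMeasurable
      (D.continuous_regressor.comp_aestronglyMeasurable ((hs i).1.prodMk ((hs i).2.1.prodMk hw)))
  have hsum : AEStronglyMeasurable (fun t => ∑ i, Lam (D.φs σ i t)) (volume.restrict (Ici 0)) :=
    Finset.aestronglyMeasurable_fun_sum _ fun i _ => hi i
  exact (h0.const_smul D.kc₁).add ((hsum.const_smul (1 / (N : ℝ))).const_smul D.kc₂)

end Design

/-! ### Assembly of the ultimate bound -/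

theorem Signals.norm_sq_errorState {n p m l N : ℕ} (σ : Signals n p m l N) (W : Vec l) (t : ℝ) :
    ‖σ.errorState W t‖ ^ 2
      = ‖σ.ξ t‖ ^ 2 + (‖W - σ.Wc t‖ ^ 2 + (‖W - σ.Wa t‖ ^ 2 + ‖W - σ.Wp t‖ ^ 2)) := by
  simp [Signals.errorState, EuclideanSpace.norm_sq_eq, Fintype.sum_sum_type]

theorem mainTheorem2 {n p m l N : ℕ} (G : PEGame n p) (D : Design G m l)
    (Ωp Ωe Ω : Set (State n)) (hΩp : IsCompact Ωp) (hΩe : IsCompact Ωe) (hΩ : IsCompact Ω)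
    (hΩsub : ∀ zp ∈ Ωp, ∀ ze ∈ Ωe, zp - ze ∈ Ω)
    -- the optimal value function and its neural network representation over `Ω`
    (V : State n → ℝ) (hV : G.IsOptimalValue V)
    (W : Vec l) (εc : State n → ℝ) (hεc : ContDiff ℝ 1 εc)
    (hNN : ∀ ξ ∈ Ω, V ξ = inner ℝ W (D.ϑ ξ) + εc ξ ∧
      gradient V ξ = ContinuousLinearMap.adjoint (fderiv ℝ D.ϑ ξ) W + gradient εc ξ)
    (dbar uebar lamc : ℝ) (hdbar : 0 < dbar) (huebar : 0 < uebar) (hlamc : 0 < lamc) :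
    UniformlyUltimatelyBounded
      {z | ∃ σ : Signals n p m l N,
        D.ClosedLoop σ ∧
        σ.DisturbanceBound dbar ∧
        σ.ObstacleBound G.η ∧
        σ.EvaderBound Ωe uebar ∧
        σ.SamplesIn Ωp Ωe ∧
        D.SamplingRank σ lamc ∧
        (∀ t, 0 ≤ t → σ.zp t ∈ Ωp) ∧
        0 < G.bx (σ.zp 0) (σ.xo 0) ∧
        0 < G.bv (σ.zp 0) ∧
        z = σ.errorState W} := by
  obtain ⟨P, hPinv, p₀, hp₀, hP₀⟩ := D.Γinit_pos.exists_coercive_leftInverse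
  obtain ⟨C, hC, hCr⟩ := D.exists_policyReward_bound hΩp hΩe
  obtain ⟨Bξ, hBξ⟩ := hΩ.isBounded.exists_norm_le
  obtain ⟨Bw, hBw⟩ := D.h_compact.isBounded.exists_norm_le
  have hβ := D.β_pos
  have hk₁ := D.kc₁_pos
  have hk₂ := D.kc₂_pos
  -- μ e^{βt} and κ e^{βt} are the lower and upper bounds of the information matrix; c₀ bounds the
  -- forcing.
  set μ := min p₀ (D.kc₂ * lamc / D.β) with hμ
  have hμ0 : 0 < μ := lt_min hp₀ (by positivity)
  set κ := ‖P‖ + (D.kc₁ + D.kc₂) / D.β with hκ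
  have hκ0 : 0 < κ := by positivity
  set c₀ := (D.kc₁ + D.kc₂) * C with hc₀
  -- One summand for each block of the error state. The 1 inside the critic summand is what remains
  -- of the transient after time T; the final 1 only makes the bound positive.
  refine ⟨|Bξ| + (‖W‖ + (1 + c₀ / D.β) / μ) + (‖W‖ + |Bw|) + (‖W‖ + |Bw|) + 1, by positivity,
    fun a ha => ?_⟩
  -- a + ‖W‖ bounds ‖Ŵ_c(t₀)‖, so T depends on a but on neither t₀ nor the trajectory.
  obtain ⟨T, hT0, hT⟩ : ∃ T, 0 ≤ T ∧ κ * Real.exp (-D.β * T) * (a + ‖W‖) ≤ 1 := by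
    have hlim : Tendsto (fun T : ℝ => κ * Real.exp (-D.β * T) * (a + ‖W‖)) atTop (𝓝 0) := by
      have h1 : Tendsto (fun T : ℝ => Real.exp (-D.β * T)) atTop (𝓝 0) :=
        Real.tendsto_exp_atBot.comp (tendsto_id.const_mul_atTop_of_neg (by linarith))
      simpa using (h1.const_mul κ).mul_const (a + ‖W‖)
    obtain ⟨T, h1, h2⟩ := ((hlim.eventually_le_const one_pos).and (eventually_ge_atTop 0)).exists
    exact ⟨T, h2, h1⟩
  refine ⟨T, hT0, ?_⟩
  rintro _ ⟨σ, hσ, -, -, hev, hsam, hrank, hzp, -, -, rfl⟩ t₀ ht₀ hza t ht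
  have ht0 : 0 ≤ t := by linarith
  have hWa := hσ.actor.smoothProj_invariant D.h_smooth hσ.Wa_init
  have hWp := hσ.perturber.smoothProj_invariant D.h_smooth hσ.Wp_init
  have hforce : ∀ u, 0 ≤ u → ‖D.criticForcing σ u‖ ≤ c₀ := fun u hu =>
    D.norm_criticForcing_le σ hC
      (hCr _ (hzp u hu) _ (hev.1 u hu) _ _ (hWa u hu) (hWp u hu))
      fun i => hCr _ ((hsam i).2.2 u hu).1 _ ((hsam i).2.2 u hu).2 _ _ (hWa u hu) (hWp u hu)
  have hls := leastSquares_norm_le hβ hp₀ (mul_pos hk₂ hlamc) (A := D.excitation σ)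
    (c := D.criticForcing σ) hσ.leastSquares
    (hσ.critic.congr_rate fun u _ => D.criticRate_eq σ u)
    (hσ.aestronglyMeasurable_excitation hsam) (fun u _ => D.norm_excitation_le σ u)
    (fun u hu => D.le_inner_excitation σ hrank hu) (by rw [hσ.Γ_init, hPinv]) le_rfl hP₀ hforce
    ht₀ (show t₀ ≤ t by linarith)
  have hsq₀ := σ.norm_sq_errorState W t₀
  have hsq := σ.norm_sq_errorState W t
  have hc₀' : ‖W - σ.Wc t₀‖ ≤ a := by
    refine le_trans (abs_le_of_sq_le_sq' ?_ (norm_nonneg _)).2 hza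
    nlinarith [sq_nonneg ‖σ.ξ t₀‖, sq_nonneg ‖W - σ.Wa t₀‖, sq_nonneg ‖W - σ.Wp t₀‖]
  have hWc₀ : ‖σ.Wc t₀‖ ≤ a + ‖W‖ := by
    have := norm_le_norm_add_norm_sub W (σ.Wc t₀)
    linarith
  have hWc : ‖σ.Wc t‖ ≤ (1 + c₀ / D.β) / μ := by
    refine hls.trans ?_
    gcongr
    refine le_trans ?_ hT
    have : Real.exp (-D.β * (t - t₀)) ≤ Real.exp (-D.β * T) :=
      Real.exp_le_exp.mpr (mul_le_mul_of_nonpos_left (by linarith) (by linarith))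
    gcongr
  have hξ : ‖σ.ξ t‖ ≤ |Bξ| :=
    (hBξ _ (hΩsub _ (hzp t ht0) _ (hev.1 t ht0))).trans (le_abs_self _)
  have e1 : ‖W - σ.Wc t‖ ≤ ‖W‖ + (1 + c₀ / D.β) / μ := (norm_sub_le _ _).trans (by gcongr)
  have e2 : ‖W - σ.Wa t‖ ≤ ‖W‖ + |Bw| :=
    (norm_sub_le _ _).trans (by gcongr; exact (hBw _ (hWa t ht0)).trans (le_abs_self _))
  have e3 : ‖W - σ.Wp t‖ ≤ ‖W‖ + |Bw| :=
    (norm_sub_le _ _).trans (by gcongr; exact (hBw _ (hWp t ht0)).trans (le_abs_self _))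
  have hle : ‖σ.errorState W t‖
      ≤ ‖σ.ξ t‖ + ‖W - σ.Wc t‖ + ‖W - σ.Wa t‖ + ‖W - σ.Wp t‖ := by
    refine (abs_le_of_sq_le_sq' ?_ (by positivity)).2
    rw [hsq]
    have := norm_nonneg (σ.ξ t)
    have := norm_nonneg (W - σ.Wc t)
    have := norm_nonneg (W - σ.Wa t)
    have := norm_nonneg (W - σ.Wp t)
    nlinarith [mul_nonneg (norm_nonneg (σ.ξ t)) (norm_nonneg (W - σ.Wc t)),
      mul_nonneg (norm_nonneg (σ.ξ t)) (norm_nonneg (W - σ.Wa t)),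
      mul_nonneg (norm_nonneg (σ.ξ t)) (norm_nonneg (W - σ.Wp t)),
      mul_nonneg (norm_nonneg (W - σ.Wc t)) (norm_nonneg (W - σ.Wa t)),
      mul_nonneg (norm_nonneg (W - σ.Wc t)) (norm_nonneg (W - σ.Wp t)),
      mul_nonneg (norm_nonneg (W - σ.Wa t)) (norm_nonneg (W - σ.Wp t))]
  linarith
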